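/- Graphs are finite and simple unless stated otherwise, $P_m$ is the path on $m$ vertices, $G+H$ is the join of $G$ and $H$, $G\cup H$ is their disjoint union, $a\cdot G$ is the disjoint union of $a$ copies of $G$, $e(G)$ is the number of edges of $G$, and $\lambda(G)$ is the largest eigenvalue of the adjacency matrix of $G$. For a family $\mathcal F$ of graphs, a graph is $\mathcal F$-free if it has no subgraph (not necessarily induced) isomorphic to a member of $\mathcal F$. Let $\mathrm{EX}(n,\mathcal F)$ and $\mathrm{SPEX}(n,\mathcal F)$ be the sets of $n$-vertex $\mathcal F$-free graphs with the maximum number of edges and with the maximum value of $\lambda$, respectively; let $\mathrm{ex}(n,\mathcal F)$ be the maximum number of edges of an $n$-vertex $\mathcal F$-free graph; and let $\mathrm{EX}^{W}(n,\mathcal F)$ be the set of graphs with the maximum number of edges among the $n$-vertex $\mathcal F$-free graphs that contain a copy of $W$. **Proposition 1.2.** There is a finite family $\mathcal F$ of graphs with the following properties. 1. There is a constant $C$ such that for all sufficiently large $n$, $\mathrm{EX}(n,\mathcal F)$ is nonempty and each of its members is isomorphic to $K_2+X$ for some graph $X$ on $n-2$ vertices with $|e(X)-3n/4|\le C$. For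 all sufficiently large $n\equiv 2\pmod 4$, up to isomorphism, $\mathrm{EX}(n,\mathcal F)$ consists of exactly one graph, $K_2+\left(P_8\cup\frac{n-10}{4}\cdot P_4\right)$. 2. For infinitely many $n$ (indeed for infinitely many $n\equiv 2\pmod 4$), $\mathrm{SPEX}(n,\mathcal F)\cap\mathrm{EX}(n,\mathcal F)=\emptyset$. 3. Consider, for a family $\mathcal F$, an integer $k$ and a real number $Q$, the implication from the hypothesis "$\mathcal F$ is finite, $\mathrm{ex}(n,\mathcal F)=O(n)$, the complete bipartite graph $K_{k+1,\infty}$ with parts of sizes $k+1$ and $\aleph_0$ is not $\mathcal F$-free, and for some constant $C'$ and all sufficiently large $n$ the set $\mathrm{EX}^{K_{k,n-k}}(n,\mathcal F)$ contains a graph of the form $K_k+X$ with $e(X)\le Qn+C'$" to the conclusion "$\mathrm{SPEX}(n,\mathcal F)\subseteq\mathrm{EX}^{K_k+\overline{K_{n-k}}}(n,\mathcal F)$ for all sufficiently large $n$". This implication fails for the above $\mathcal F$ with $k=2$ and $Q=3/4$: the hypothesis holds and the conclusion does not. (Case (d) of Theorem 1.1 is this implication for $0\le Q<3/4$.) -/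

import Mathlib

open Filter Asymptotics SimpleGraph
open scoped Topology

namespace TuranSpectral

/-- A family of finite graphs, each represented on a vertex set `Fin m`. -/
abbrev GraphFamily : Type := Set (Σ m : ℕ, SimpleGraph (Fin m))

/-- The join `G + H`: disjoint copies of `G` and `H` and all edges between them. -/
def join {V W : Type} (G : SimpleGraph V) (H : SimpleGraph W) : SimpleGraph (V ⊕ W) :=
  (G ⊕g H) ⊔ completeBipartiteGraph V W

/-- The disjoint union `a · G` of `a` copies of `G`. -/
def copies {V : Type} (a : ℕ) (G : SimpleGraph V) : SimpleGraph (Fin a × V) where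
  Adj p q := p.1 = q.1 ∧ G.Adj p.2 q.2
  symm := ⟨fun _ _ h => ⟨h.1.symm, h.2.symm⟩⟩
  loopless := ⟨fun _ h => G.irrefl h.2⟩

/-- The number of edges `e(G)` of a graph. -/
noncomputable def numEdges {V : Type} (G : SimpleGraph V) : ℕ := G.edgeSet.ncard

/-- `G` is `𝓕`-free: no member of `𝓕` is a (not necessarily induced) subgraph of `G`. -/
def FamilyFree (𝓕 : GraphFamily) {V : Type} (G : SimpleGraph V) : Prop :=
  ∀ F ∈ 𝓕, F.2.Free G

/-- The largest eigenvalue `λ(G)` of the adjacency matrix of a finite graph. -/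
noncomputable def lam {V : Type} [Fintype V] (G : SimpleGraph V) : ℝ :=
  open scoped Classical in sSup (spectrum ℝ (G.adjMatrix ℝ))

/-- `ex(n, 𝓕)`: the maximum number of edges of an `𝓕`-free graph on `n` vertices. -/
noncomputable def ex (n : ℕ) (𝓕 : GraphFamily) : ℕ :=
  open scoped Classical in
  Finset.sup (Finset.univ.filter fun G : SimpleGraph (Fin n) => FamilyFree 𝓕 G) numEdges

/-- `EX(n, 𝓕)`: the `𝓕`-free graphs on `n` labelled vertices with the maximum number of edges. -/
def EX (n : ℕ) (𝓕 : GraphFamily) : Set (SimpleGraph (Fin n)) :=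
  {G | FamilyFree 𝓕 G ∧
    ∀ G' : SimpleGraph (Fin n), FamilyFree 𝓕 G' → numEdges G' ≤ numEdges G}

/-- `EX^W(n, 𝓕)`: the graphs with the maximum number of edges among the `𝓕`-free graphs on `n`
labelled vertices that contain a copy of `W`. -/
def EXContaining {U : Type} (W : SimpleGraph U) (n : ℕ) (𝓕 : GraphFamily) :
    Set (SimpleGraph (Fin n)) :=
  {G | (FamilyFree 𝓕 G ∧ W ⊑ G) ∧
    ∀ G' : SimpleGraph (Fin n), FamilyFree 𝓕 G' → W ⊑ G' → numEdges G' ≤ numEdges G}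

/-- `SPEX(n, 𝓕)`: the `𝓕`-free graphs on `n` labelled vertices with the maximum `λ`. -/
def SPEX (n : ℕ) (𝓕 : GraphFamily) : Set (SimpleGraph (Fin n)) :=
  {G | FamilyFree 𝓕 G ∧ ∀ G' : SimpleGraph (Fin n), FamilyFree 𝓕 G' → lam G' ≤ lam G}

/-- The condition: `𝓕` is finite, `ex(n, 𝓕) = O(n)`, `K_{k+1,∞}` is not `𝓕`-free, and for all
large `n` some graph in `EX^{K_{k,n-k}}(n, 𝓕)` has the form `K_k + X` with `e(X) ≤ Qn + O(1)`. -/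
def HasLinearJoinExtremal (𝓕 : GraphFamily) (k : ℕ) (Q : ℝ) : Prop :=
  𝓕.Finite ∧
  (fun n : ℕ => (ex n 𝓕 : ℝ)) =O[atTop] (fun n : ℕ => (n : ℝ)) ∧
  ¬ FamilyFree 𝓕 (completeBipartiteGraph (Fin (k + 1)) ℕ) ∧
  ∃ C : ℝ, ∀ᶠ n : ℕ in atTop,
    ∃ H ∈ EXContaining (completeBipartiteGraph (Fin k) (Fin (n - k))) n 𝓕,
      ∃ X : SimpleGraph (Fin (n - k)),
        Nonempty (H ≃g join (completeGraph (Fin k)) X) ∧ (numEdges X : ℝ) ≤ Q * n + C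

/-- The conclusion: for all large `n`, every graph in `SPEX(n, 𝓕)` has the maximum number of edges
among the `n`-vertex `𝓕`-free graphs that contain the join of `K_k` and `n - k` isolated
vertices. -/
def SpexSubsetEventually (𝓕 : GraphFamily) (k : ℕ) : Prop :=
  ∀ᶠ n : ℕ in atTop,
    SPEX n 𝓕 ⊆
      EXContaining (join (completeGraph (Fin k)) (emptyGraph (Fin (n - k)))) n 𝓕

end TuranSpectral

namespace TuranSpectral

/-! Take the family whose free graphs are exactly those that become admissible after deleting at
most two vertices. Admissible means that either every component lies in a path on at most eight
vertices, with at most one component of five or more vertices, or every component lies in `K_{1,3}`.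
Both conditions test only connected sets of bounded size, so they pass to subgraphs and fail on
boundedly many vertices. A bounded branching argument then makes the family finite
(`familyFree_obstructionFamily_iff`).

Every free graph lies in `K_2 + X` with `X` admissible, and such joins are free, so the edge problem
is to maximise `e(X)` on `m = n - 2` vertices. Star-like graphs have at most `3m/4` edges. Path-like
ones have at most `3m/4 + 1`, with equality only for one `P_8` and copies of `P_4`
(`AdmissibleOn.nonempty_iso`).

The spectral problem prefers stars. In an eigenvector equal to `1` on `K_2`, the entries on `X` sum
to a series in walk counts, `2m/μ + 4e(X)/μ² + 2∑d²/μ³ + ...`. The extra edge of the path graph is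
worth about `4/μ²`. Each `K_{1,3}` exceeds `P_4` by `2` in `∑d²`, and with about `μ²/8` blocks this
gains about `1/(2μ)`, which wins for large `μ`. `lam_join_paths_lt_lam_join_stars` makes this exact
with explicit weight vectors. Since extremal graphs contain `K_2` joined to an independent set, the
spectral inclusion fails as well. -/

/-- On the vertex set `U`, every connected set of at most nine vertices spans a subgraph of a path
on at most eight vertices, and no two connected sets of five vertices are disjoint. -/
def PathLikeOn {V : Type} (G : SimpleGraph V) (U : Set V) : Prop :=
  (∀ T : Finset V, ↑T ⊆ U → T.card ≤ 9 → (G.induce (T : Set V)).Connected →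
    T.card ≤ 8 ∧ G.induce (T : Set V) ⊑ pathGraph T.card) ∧
  ∀ T₁ T₂ : Finset V, ↑T₁ ⊆ U → ↑T₂ ⊆ U → T₁.card = 5 → T₂.card = 5 →
    (G.induce (T₁ : Set V)).Connected → (G.induce (T₂ : Set V)).Connected → ¬ Disjoint T₁ T₂

/-- On the vertex set `U`, every connected set of at most five vertices spans a subgraph of
`K_{1,3}`. -/
def StarLikeOn {V : Type} (G : SimpleGraph V) (U : Set V) : Prop :=
  ∀ T : Finset V, ↑T ⊆ U → T.card ≤ 5 → (G.induce (T : Set V)).Connected →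
    G.induce (T : Set V) ⊑ starGraph (0 : Fin 4)

/-- The graph is path-like or star-like on `U`. -/
def AdmissibleOn {V : Type} (G : SimpleGraph V) (U : Set V) : Prop :=
  PathLikeOn G U ∨ StarLikeOn G U

/-! ### Monotonicity of admissibility -/

section Mono

variable {V W : Type} {G : SimpleGraph V} {H : SimpleGraph W}

lemma exists_image_finset {T : Finset V} {f : V → W} (hinj : Set.InjOn f T)
    (hadj : ∀ a ∈ T, ∀ b ∈ T, G.Adj a b → H.Adj (f a) (f b)) :
    ∃ T' : Finset W, (T' : Set W) = f '' T ∧ T'.card = T.card ∧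
      G.induce (T : Set V) ⊑ H.induce (T' : Set W) ∧
      ((G.induce (T : Set V)).Connected → (H.induce (T' : Set W)).Connected) := by
  classical
  refine ⟨T.image f, by simp, Finset.card_image_of_injOn hinj, ?_, ?_⟩
  · refine ⟨⟨⟨fun a => ⟨f a.1, by simpa using ⟨a.1, a.2, rfl⟩⟩, ?_⟩, ?_⟩⟩
    · intro a b hab
      exact hadj a.1 a.2 b.1 b.2 hab
    · intro a b hab
      exact Subtype.ext (hinj a.2 b.2 (congrArg Subtype.val hab))
  · intro hc
    let g : G.induce (T : Set V) →g H.induce ((T.image f : Finset W) : Set W) :=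
      ⟨fun a => ⟨f a.1, by simpa using ⟨a.1, a.2, rfl⟩⟩, fun {a b} hab =>
        hadj a.1 a.2 b.1 b.2 hab⟩
    refine hc.map g ?_
    rintro ⟨b, hb⟩
    obtain ⟨a, ha, rfl⟩ := Finset.mem_image.mp (Finset.mem_coe.mp hb)
    exact ⟨⟨a, ha⟩, rfl⟩

/-- Connected sets map to connected sets of the same size, and disjoint ones stay disjoint, so every
test in the source is implied by a test in the target. -/
lemma AdmissibleOn.of_map {U : Set V} {U' : Set W} (h : AdmissibleOn H U') {f : V → W}
    (hinj : Set.InjOn f U) (hmaps : Set.MapsTo f U U')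
    (hadj : ∀ a ∈ U, ∀ b ∈ U, G.Adj a b → H.Adj (f a) (f b)) : AdmissibleOn G U := by
  have key : ∀ T : Finset V, (T : Set V) ⊆ U → ∃ T' : Finset W, (T' : Set W) = f '' T ∧
      T'.card = T.card ∧ G.induce (T : Set V) ⊑ H.induce (T' : Set W) ∧
      ((G.induce (T : Set V)).Connected → (H.induce (T' : Set W)).Connected) := fun T hT =>
    exists_image_finset (hinj.mono hT) fun a ha b hb => hadj a (hT ha) b (hT hb)
  have hsub : ∀ T : Finset V, (T : Set V) ⊆ U → f '' T ⊆ U' := fun T hT =>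
    Set.image_subset_iff.mpr fun a ha => hmaps (hT ha)
  rcases h with ⟨h1, h2⟩ | h
  · refine Or.inl ⟨fun T hT hc hcon => ?_, fun T₁ T₂ hT₁ hT₂ hc₁ hc₂ hcon₁ hcon₂ hd => ?_⟩
    · obtain ⟨T', he, hcard, hle, hcon'⟩ := key T hT
      have := h1 T' (he ▸ hsub T hT) (hcard ▸ hc) (hcon' hcon)
      rw [hcard] at this
      exact ⟨this.1, hle.trans this.2⟩
    · obtain ⟨T₁', he₁, hcard₁, -, hcon₁'⟩ := key T₁ hT₁
      obtain ⟨T₂', he₂, hcard₂, -, hcon₂'⟩ := key T₂ hT₂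
      refine h2 T₁' T₂' (he₁ ▸ hsub T₁ hT₁) (he₂ ▸ hsub T₂ hT₂) (hcard₁ ▸ hc₁) (hcard₂ ▸ hc₂)
        (hcon₁' hcon₁) (hcon₂' hcon₂) ?_
      rw [← Finset.disjoint_coe, he₁, he₂]
      rw [Set.disjoint_left]
      rintro - ⟨a, ha, rfl⟩ ⟨b, hb, hab⟩
      exact Finset.disjoint_left.mp hd ha (hinj (hT₂ hb) (hT₁ ha) hab ▸ hb)
  · refine Or.inr fun T hT hc hcon => ?_
    obtain ⟨T', he, hcard, hle, hcon'⟩ := key T hT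
    exact hle.trans (h T' (he ▸ hsub T hT) (hcard ▸ hc) (hcon' hcon))

lemma AdmissibleOn.mono {U U' : Set V} (h : AdmissibleOn G U') (hU : U ⊆ U') :
    AdmissibleOn G U :=
  h.of_map (f := id) Function.injective_id.injOn hU fun _ _ _ _ => id

end Mono

/-! ### The finite family of obstructions -/

/-- Failure of admissibility is witnessed on at most fifteen vertices. -/
lemma exists_small_not_admissibleOn {V : Type} {G : SimpleGraph V} {U : Set V}
    (h : ¬ AdmissibleOn G U) :
    ∃ O : Finset V, ↑O ⊆ U ∧ O.card ≤ 15 ∧ ¬ AdmissibleOn G O := by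
  classical
  rw [AdmissibleOn, not_or] at h
  obtain ⟨hp, hs⟩ := h
  -- Ten covers both failures of the path condition: one bad set of at most nine vertices, or two
  -- disjoint five-sets. A bad set for the star condition adds at most five.
  have hp' : ∃ O : Finset V, ↑O ⊆ U ∧ O.card ≤ 10 ∧
      ∀ O' : Finset V, O ⊆ O' → ¬ PathLikeOn G O' := by
    rw [PathLikeOn, not_and_or] at hp
    rcases hp with hp | hp
    · push Not at hp
      obtain ⟨T, hT, hc, hcon, hbad⟩ := hp
      refine ⟨T, hT, by omega, fun O' hO' hP => ?_⟩
      obtain ⟨h8, hle⟩ := hP.1 T (Finset.coe_subset.mpr hO') hc hcon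
      exact (hbad h8).false hle.some
    · push Not at hp
      obtain ⟨T₁, T₂, hT₁, hT₂, hc₁, hc₂, hcon₁, hcon₂, hd⟩ := hp
      refine ⟨T₁ ∪ T₂, by simp [hT₁, hT₂], ?_, fun O' hO' hP => ?_⟩
      · have := Finset.card_union_le T₁ T₂
        omega
      · exact hP.2 T₁ T₂ (Finset.coe_subset.mpr (Finset.subset_union_left.trans hO'))
          (Finset.coe_subset.mpr (Finset.subset_union_right.trans hO')) hc₁ hc₂ hcon₁ hcon₂ hd
  obtain ⟨O, hO, hc, hbad⟩ := hp'
  rw [StarLikeOn] at hs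
  push Not at hs
  obtain ⟨T, hT, hcT, hcon, hbadT⟩ := hs
  refine ⟨O ∪ T, by simp [hO, hT], ?_, ?_⟩
  · have := Finset.card_union_le O T
    omega
  · rintro (hP | hS)
    · exact hbad _ Finset.subset_union_left hP
    · exact hbadT.false
        (hS T (Finset.coe_subset.mpr Finset.subset_union_right) hcT hcon).some

/-- The graphs on at most `15 + 15 * 15 + 15 * 15 * 15` vertices which do not become admissible
by deleting at most two vertices. -/
def obstructionFamily : GraphFamily :=
  {F | F.1 ≤ 15 + 15 * 15 + 15 * 15 * 15 ∧
    ∀ S : Finset (Fin F.1), S.card ≤ 2 → ¬ AdmissibleOn F.2 (↑S)ᶜ}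

lemma obstructionFamily_finite : obstructionFamily.Finite := by
  have : (⋃ m ∈ Set.Iic (15 + 15 * 15 + 15 * 15 * 15),
      Set.range (Sigma.mk (β := fun m => SimpleGraph (Fin m)) m)).Finite :=
    Set.Finite.biUnion (Set.finite_Iic _) fun m _ => Set.finite_range (Sigma.mk m)
  refine this.subset ?_
  rintro ⟨m, F⟩ ⟨hm, -⟩
  simp only [Set.mem_iUnion]
  exact ⟨m, hm, F, rfl⟩

/-- If no two vertices meet all the inadmissible sets, this is witnessed on boundedly many
vertices. -/
lemma exists_small_forall_not_admissibleOn {V : Type} {G : SimpleGraph V}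
    (h : ∀ S : Finset V, S.card ≤ 2 → ¬ AdmissibleOn G (↑S)ᶜ) :
    ∃ W : Finset V, W.card ≤ 15 + 15 * 15 + 15 * 15 * 15 ∧
      ∀ S : Finset V, S.card ≤ 2 → ¬ AdmissibleOn G (↑W \ ↑S) := by
  classical
  have h' : ∀ S : Finset V, ∃ O : Finset V, S.card ≤ 2 → ↑O ⊆ (S : Set V)ᶜ ∧ O.card ≤ 15 ∧
      ¬ AdmissibleOn G O := by
    intro S
    by_cases hS : S.card ≤ 2
    · obtain ⟨O, hO⟩ := exists_small_not_admissibleOn (h S hS)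
      exact ⟨O, fun _ => hO⟩
    · exact ⟨∅, fun h => absurd h hS⟩
  choose O hO using h'
  have hO1 : ∀ v, ({v} : Finset V).card ≤ 2 := fun v => by simp
  have hO2 : ∀ v w, ({v, w} : Finset V).card ≤ 2 := fun v w => Finset.card_le_two
  have hO0 : (∅ : Finset V).card ≤ 2 := by simp
  -- A search tree of depth three: a set `S` that repairs everything must meet `O ∅` in some `v`,
  -- then `O {v}` in some `w`, then `O {v, w}` in some `x`. These are distinct, too many for two
  -- deletions.
  let A : Finset V := (O ∅).biUnion fun v => O {v}
  let B : Finset V := (O ∅).biUnion fun v => (O {v}).biUnion fun w => O {v, w}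
  have hA : A.card ≤ 15 * 15 :=
    (Finset.card_biUnion_le_card_mul _ _ 15 fun v _ => (hO {v} (hO1 v)).2.1).trans
      (Nat.mul_le_mul_right _ (hO ∅ hO0).2.1)
  have hB : B.card ≤ 15 * (15 * 15) :=
    (Finset.card_biUnion_le_card_mul _ _ (15 * 15) fun v _ =>
      (Finset.card_biUnion_le_card_mul _ _ 15 fun w _ => (hO {v, w} (hO2 v w)).2.1).trans
      (Nat.mul_le_mul_right _ (hO {v} (hO1 v)).2.1)).trans
      (Nat.mul_le_mul_right _ (hO ∅ hO0).2.1)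
  refine ⟨O ∅ ∪ A ∪ B, ?_, fun S hS hadm => ?_⟩
  · have h1 := Finset.card_union_le (O ∅ ∪ A) B
    have h2 := Finset.card_union_le (O ∅) A
    have h3 := (hO ∅ hO0).2.1
    omega
  · have meets : ∀ S' : Finset V, S'.card ≤ 2 → O S' ⊆ O ∅ ∪ A ∪ B → ∃ v ∈ O S', v ∈ S := by
      intro S' hS' hsub
      by_contra! hcon
      exact (hO S' hS').2.2 (hadm.mono fun x hx => ⟨Finset.coe_subset.mpr hsub hx, hcon x hx⟩)
    obtain ⟨v, hv, hvS⟩ := meets ∅ hO0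
      (Finset.subset_union_left.trans Finset.subset_union_left)
    obtain ⟨w, hw, hwS⟩ := meets {v} (hO1 v) fun x hx => by
      simp only [Finset.mem_union, A, Finset.mem_biUnion]
      exact Or.inl (Or.inr ⟨v, hv, hx⟩)
    obtain ⟨x, hx, hxS⟩ := meets {v, w} (hO2 v w) fun x hx => by
      simp only [Finset.mem_union, B, Finset.mem_biUnion]
      exact Or.inr ⟨v, hv, w, hw, hx⟩
    have hwv : w ≠ v := fun e => (hO {v} (hO1 v)).1 hw (by simp [e])
    have hxv : x ≠ v := fun e => (hO {v, w} (hO2 v w)).1 hx (by simp [e])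
    have hxw : x ≠ w := fun e => (hO {v, w} (hO2 v w)).1 hx (by simp [e])
    have h3 : ({v, w, x} : Finset V).card = 3 :=
      Finset.card_eq_three.mpr ⟨v, w, x, hwv.symm, hxv.symm, hxw.symm, rfl⟩
    have : ({v, w, x} : Finset V) ⊆ S := by
      intro y hy
      simp only [Finset.mem_insert, Finset.mem_singleton] at hy
      rcases hy with rfl | rfl | rfl <;> assumption
    have := Finset.card_le_card this
    omega

/-- The graphs free of the obstruction family are those which become admissible by deleting at
most two vertices. -/
theorem familyFree_obstructionFamily_iff {V : Type} {G : SimpleGraph V} :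
    FamilyFree obstructionFamily G ↔
      ∃ S : Finset V, S.card ≤ 2 ∧ AdmissibleOn G (↑S)ᶜ := by
  classical
  constructor
  · intro hfree
    by_contra! hcon
    obtain ⟨W, hW, hbad⟩ := exists_small_forall_not_admissibleOn hcon
    let e : Fin W.card ≃ W := W.equivFin.symm
    let f : Fin W.card ↪ V := e.toEmbedding.trans (Function.Embedding.subtype _)
    refine hfree ⟨W.card, G.comap f⟩ ⟨hW, fun S hS hadm => ?_⟩ ⟨(Embedding.comap f G).toCopy⟩
    refine hbad (S.map f) (by simpa using hS) ?_
    -- `Function.invFun` needs a nonempty domain; for empty `W` there is no connected set to test.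
    rcases W.eq_empty_or_nonempty with rfl | ⟨w, hw⟩
    · exact Or.inr fun T hT _ hc => by simpa using hT hc.nonempty.some.2
    · have hf : ∀ v (hv : v ∈ W), f (e.symm ⟨v, hv⟩) = v := fun v hv => by simp [f]
      have hg : ∀ v ∈ W, ∃ a, f a = v := fun v hv => ⟨_, hf v hv⟩
      have : Nonempty (Fin W.card) := ⟨e.symm ⟨w, hw⟩⟩
      have hinv : ∀ v ∈ W, f (Function.invFun f v) = v := fun v hv =>
        Function.invFun_eq (hg v hv)
      refine hadm.of_map (f := Function.invFun f) (fun a ha b hb hab => ?_) (fun a ha => ?_) ?_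
      · rw [← hinv a ha.1, ← hinv b hb.1, hab]
      · rintro haS
        exact ha.2 (Finset.mem_coe.mpr (Finset.mem_map.mpr ⟨_, haS, hinv a ha.1⟩))
      · intro a ha b hb hab
        change G.Adj (f _) (f _)
        rwa [hinv a ha.1, hinv b hb.1]
  · rintro ⟨S, hS, hadm⟩ ⟨m, F⟩ ⟨-, hF⟩ ⟨f⟩
    refine hF (Finset.univ.filter fun a => f a ∈ S) ?_ ?_
    · refine (Finset.card_le_card_of_injOn f (fun a ha => ?_) f.injective.injOn).trans hS
      simpa using ha
    · refine hadm.of_map (f := f) f.injective.injOn (fun a ha => by simpa using ha) ?_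
      intro a _ b _ hab
      exact f.toHom.map_adj hab

lemma FamilyFree.of_isContained {𝓕 : GraphFamily} {V W : Type} {G : SimpleGraph V}
    {H : SimpleGraph W} (h : FamilyFree 𝓕 H) (hGH : G ⊑ H) : FamilyFree 𝓕 G :=
  fun F hF hFG => h F hF (hFG.trans hGH)

/-- An infinite star `K_{3,∞}` contains one of the obstructions. -/
lemma not_familyFree_completeBipartiteGraph :
    ¬ FamilyFree obstructionFamily (completeBipartiteGraph (Fin 3) ℕ) := by
  classical
  rw [familyFree_obstructionFamily_iff]
  rintro ⟨S, hS, hadm⟩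
  obtain ⟨i, hi⟩ : ∃ i : Fin 3, Sum.inl i ∉ S := by
    by_contra! h
    have := Finset.card_le_card_of_injOn (s := (Finset.univ : Finset (Fin 3))) (t := S)
      (Sum.inl : Fin 3 → Fin 3 ⊕ ℕ) (fun i _ => h i) Sum.inl_injective.injOn
    simp at this
    omega
  have hinf : {j : ℕ | Sum.inr j ∉ S}.Infinite := by
    have : {j : ℕ | Sum.inr j ∈ S}.Finite :=
      (S.finite_toSet.preimage (f := (Sum.inr : ℕ → Fin 3 ⊕ ℕ)) Sum.inr_injective.injOn)
    exact this.infinite_compl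
  -- Stars centred at a surviving vertex of the small side: nine vertices break the path condition,
  -- five break the star condition.
  have key : ∀ k : ℕ, ∃ T : Finset (Fin 3 ⊕ ℕ), ↑T ⊆ (S : Set (Fin 3 ⊕ ℕ))ᶜ ∧ T.card = k + 1 ∧
      ((completeBipartiteGraph (Fin 3) ℕ).induce (T : Set (Fin 3 ⊕ ℕ))).Connected := by
    intro k
    obtain ⟨J, hJ, hk⟩ := hinf.exists_subset_card_eq k
    refine ⟨insert (Sum.inl i) (J.map ⟨Sum.inr, Sum.inr_injective⟩), ?_, ?_, ?_⟩
    · intro x hx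
      simp only [Finset.coe_insert, Finset.coe_map, Set.mem_insert_iff, Set.mem_image] at hx
      rcases hx with rfl | ⟨j, hj, rfl⟩
      · simpa using hi
      · simpa using hJ hj
    · rw [Finset.card_insert_of_notMem (by simp)]
      simp [hk]
    · refine Connected.of_isUniversal (v := ⟨Sum.inl i, by simp⟩) ?_
      rintro ⟨x, hx⟩ hne
      simp only [Finset.coe_insert, Finset.coe_map, Set.mem_insert_iff, Set.mem_image] at hx
      rcases hx with rfl | ⟨j, hj, rfl⟩
      · exact absurd rfl hne
      · simp
  rcases hadm with h | h
  · obtain ⟨T, hT, hc, hcon⟩ := key 8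
    have := (h.1 T hT (by omega) hcon).1
    omega
  · obtain ⟨T, hT, hc, hcon⟩ := key 4
    obtain ⟨f⟩ := h T hT (by omega) hcon
    have := Fintype.card_le_of_injective f f.injective
    simp at this
    omega

/-! ### Counting edges under containment -/

section Edges

variable {V W : Type} {G : SimpleGraph V} {H : SimpleGraph W}

lemma numEdges_le_of_isContained [Finite W] (h : G ⊑ H) : numEdges G ≤ numEdges H := by
  obtain ⟨f⟩ := h
  rw [numEdges, numEdges, ← Nat.card_coe_set_eq, ← Nat.card_coe_set_eq]
  exact Nat.card_le_card_of_injective f.mapEdgeSet f.mapEdgeSet.injective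

lemma numEdges_eq_of_iso [Finite V] [Finite W] (e : G ≃g H) : numEdges G = numEdges H :=
  le_antisymm (numEdges_le_of_isContained e.isContained) (numEdges_le_of_isContained e.isContained')

lemma eq_of_le_of_numEdges_le [Finite V] {G' : SimpleGraph V} (h : G ≤ G')
    (hc : numEdges G' ≤ numEdges G) : G = G' :=
  edgeSet_injective (Set.eq_of_subset_of_ncard_le (edgeSet_mono h) hc)

lemma nonempty_iso_of_isContained [Finite V] [Finite W] (h : G ⊑ H) (hV : Nat.card V = Nat.card W)
    (hc : numEdges H ≤ numEdges G) : Nonempty (G ≃g H) := by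
  obtain ⟨f⟩ := h
  have hf : Function.Bijective f := by
    have := Fintype.ofFinite V
    have := Fintype.ofFinite W
    rw [Fintype.bijective_iff_injective_and_card]
    exact ⟨f.injective, by simpa using hV⟩
  let e : V ≃ W := Equiv.ofBijective f hf
  have heq : G = H.comap e := by
    refine eq_of_le_of_numEdges_le (fun a b hab => f.toHom.map_adj hab) ?_
    rwa [numEdges_eq_of_iso (Iso.comap e H)]
  exact ⟨⟨e, fun {a b} => by rw [heq]; rfl⟩⟩

lemma numEdges_pathGraph_succ_le (k : ℕ) : numEdges (pathGraph (k + 1)) ≤ k := by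
  have hsub : (pathGraph (k + 1)).edgeSet ⊆
      Set.range fun i : Fin k => s(i.castSucc, i.succ) := by
    intro e
    induction e with
    | h u v =>
      intro h
      rw [mem_edgeSet, pathGraph_adj] at h
      rcases h with h | h
      · exact ⟨⟨u, by omega⟩, by rw [Sym2.eq_iff]; left; constructor <;> ext <;> simp [h]⟩
      · exact ⟨⟨v, by omega⟩, by rw [Sym2.eq_iff]; right; constructor <;> ext <;> simp [h]⟩
  refine (Set.ncard_le_ncard hsub (Set.finite_range _)).trans ?_
  rw [← Set.image_univ]
  refine (Set.ncard_image_le Set.finite_univ).trans ?_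
  simp

lemma two_mul_numEdges_eq_sum_degree [Fintype V] [DecidableRel G.Adj] :
    2 * numEdges G = ∑ v, G.degree v := by
  classical
  rw [sum_degrees_eq_twice_card_edges, numEdges, ← coe_edgeFinset, Set.ncard_coe_finset]

lemma numEdges_add_one_le_of_isContained_pathGraph {k : ℕ} (hk : k ≠ 0) (h : G ⊑ pathGraph k) :
    numEdges G + 1 ≤ k := by
  obtain ⟨k, rfl⟩ := Nat.exists_eq_succ_of_ne_zero hk
  have := (numEdges_le_of_isContained h).trans (numEdges_pathGraph_succ_le k)
  omega

lemma numEdges_add_one_of_isContained_starGraph [Finite V] {c : W} (hG : G.Connected)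
    (h : G ⊑ starGraph c) : numEdges G + 1 = Nat.card V := by
  classical
  have := Fintype.ofFinite V
  obtain ⟨f⟩ := h
  have ht : G.IsTree := ⟨hG, (isAcyclic_starGraph c).comap f.toHom f.injective⟩
  rw [Nat.card_eq_fintype_card, ← ht.card_edgeFinset, numEdges, ← coe_edgeFinset,
    Set.ncard_coe_finset]

end Edges

/-! ### Components and the edge bound for admissible graphs -/

section Components

variable {V : Type} {X : SimpleGraph V}

/-- Every finite connected set contains connected sets of all smaller positive sizes. -/
lemma exists_connected_subset_card_eq {T : Finset V} (hT : (X.induce (T : Set V)).Connected) {k : ℕ}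
    (hk : 0 < k) (hkT : k ≤ T.card) :
    ∃ T' ⊆ T, T'.card = k ∧ (X.induce (T' : Set V)).Connected := by
  classical
  induction hm : T.card - k generalizing T with
  | zero => exact ⟨T, subset_rfl, by omega, hT⟩
  | succ m ih =>
    have : Nontrivial (T : Set V) := by
      rw [Set.nontrivial_coe_sort, Finset.nontrivial_coe, ← Finset.one_lt_card_iff_nontrivial]
      omega
    -- Remove a non-cut vertex and recurse.
    obtain ⟨v, hv⟩ := hT.exists_connected_induce_compl_singleton_of_finite_nontrivial
    have hc : (T.erase v).card = T.card - 1 := Finset.card_erase_of_mem v.2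
    let g : (X.induce (T : Set V)).induce {v}ᶜ →g X.induce ((T.erase v : Finset V) : Set V) :=
      ⟨fun a => ⟨a.1.1, Finset.mem_coe.mpr (Finset.mem_erase.mpr
        ⟨fun h => a.2 (Subtype.ext h), a.1.2⟩)⟩, fun {a b} hab => hab⟩
    have hcon : (X.induce ((T.erase v : Finset V) : Set V)).Connected := by
      refine hv.map g ?_
      rintro ⟨a, ha⟩
      have ha' := Finset.mem_erase.mp (Finset.mem_coe.mp ha)
      exact ⟨⟨⟨a, ha'.2⟩, fun h => ha'.1 (congrArg Subtype.val h)⟩, rfl⟩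
    obtain ⟨T', hT', h⟩ := ih hcon (by omega) (by omega)
    exact ⟨T', hT'.trans (Finset.erase_subset _ _), h⟩

variable [Fintype V]

open scoped Classical in
/-- The vertex set of a component, as a finset. -/
noncomputable def componentFinset (C : X.ConnectedComponent) : Finset V :=
  Finset.univ.filter fun v => X.connectedComponentMk v = C

lemma mem_componentFinset {C : X.ConnectedComponent} {v : V} :
    v ∈ componentFinset C ↔ X.connectedComponentMk v = C := by
  simp [componentFinset]

lemma connected_componentFinset (C : X.ConnectedComponent) :
    (X.induce (componentFinset C : Set V)).Connected := by
  have : (componentFinset C : Set V) = C.supp := by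
    ext v
    simp [mem_componentFinset]
  rw [this]
  exact C.connected_toSimpleGraph

lemma card_componentFinset_pos (C : X.ConnectedComponent) : 0 < (componentFinset C).card := by
  obtain ⟨v, rfl⟩ := C.exists_rep
  exact Finset.card_pos.mpr ⟨v, mem_componentFinset.mpr rfl⟩

lemma disjoint_componentFinset {C D : X.ConnectedComponent} (h : C ≠ D) :
    Disjoint (componentFinset C) (componentFinset D) := by
  rw [Finset.disjoint_left]
  intro v hC hD
  exact h ((mem_componentFinset.mp hC).symm.trans (mem_componentFinset.mp hD))

lemma sum_card_componentFinset [Fintype X.ConnectedComponent] :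
    ∑ C : X.ConnectedComponent, (componentFinset C).card = Fintype.card V := by
  classical
  rw [← Finset.card_univ, Finset.card_eq_sum_card_fiberwise (f := X.connectedComponentMk)
    (t := Finset.univ) (fun _ _ => by simp)]
  refine Finset.sum_congr rfl fun C _ => ?_
  congr 1

lemma sum_numEdges_componentFinset [Fintype X.ConnectedComponent] :
    ∑ C : X.ConnectedComponent, numEdges (X.induce (componentFinset C : Set V)) = numEdges X := by
  classical
  refine Nat.eq_of_mul_eq_mul_left two_pos ?_
  rw [two_mul_numEdges_eq_sum_degree, Finset.mul_sum,
    ← Finset.sum_fiberwise (s := Finset.univ) (g := X.connectedComponentMk)]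
  refine Finset.sum_congr rfl fun C _ => ?_
  rw [two_mul_numEdges_eq_sum_degree]
  have hfil : (Finset.univ.filter fun v => X.connectedComponentMk v = C) = componentFinset C := by
    ext v
    simp [mem_componentFinset]
  rw [hfil, ← Finset.sum_coe_sort (componentFinset C)]
  refine Finset.sum_congr rfl fun v _ => ?_
  rw [← card_neighborFinset_eq_degree, ← card_neighborFinset_eq_degree]
  refine Finset.card_bij (fun a _ => a.1) ?_ ?_ ?_
  · intro a ha
    simpa using ha
  · intro a _ b _ hab
    exact Subtype.ext hab
  · intro b hb
    have hb' : X.Adj v b := by simpa using hb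
    have hbC : b ∈ componentFinset C := by
      have := mem_componentFinset.mp v.2
      rw [mem_componentFinset, ← this]
      exact ConnectedComponent.connectedComponentMk_eq_of_adj hb'.symm
    exact ⟨⟨b, hbC⟩, by simpa using hb', rfl⟩

/-- A component is a tree on `c ≤ 4` vertices, because a larger one would contain a connected
five-set; hence it has `c - 1 ≤ 3c/4` edges. -/
lemma StarLikeOn.four_mul_numEdges_le (h : StarLikeOn X Set.univ) :
    4 * numEdges X ≤ 3 * Fintype.card V := by
  classical
  have := Fintype.ofFinite X.ConnectedComponent
  rw [← sum_numEdges_componentFinset, ← sum_card_componentFinset (X := X), Finset.mul_sum,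
    Finset.mul_sum]
  refine Finset.sum_le_sum fun C _ => ?_
  have hcon := connected_componentFinset C
  have h4 : ∀ T : Finset V, T.card ≤ 5 → (X.induce (T : Set V)).Connected → T.card ≤ 4 := by
    intro T hT hc
    obtain ⟨f⟩ := h T (Set.subset_univ _) hT hc
    simpa using Fintype.card_le_of_injective f f.injective
  have hle : (componentFinset C).card ≤ 4 := by
    by_contra! hlt
    obtain ⟨T', -, hT', hc⟩ := exists_connected_subset_card_eq hcon (k := 5) (by omega) hlt
    have := h4 T' hT'.le hc
    omega
  have := numEdges_add_one_of_isContained_starGraph hcon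
    (h _ (Set.subset_univ _) (by omega) hcon)
  simp only [SetLike.coe_sort_coe, Nat.card_eq_fintype_card, Fintype.card_coe] at this
  omega

lemma PathLikeOn.component (h : PathLikeOn X Set.univ) (C : X.ConnectedComponent) :
    (componentFinset C).card ≤ 8 ∧
    X.induce (componentFinset C : Set V) ⊑ pathGraph (componentFinset C).card := by
  have hcon := connected_componentFinset C
  refine h.1 _ (Set.subset_univ _) ?_ hcon
  by_contra! hlt
  obtain ⟨T', -, hT', hc⟩ := exists_connected_subset_card_eq hcon (k := 9) (by omega) hlt.le
  have := (h.1 T' (Set.subset_univ _) hT'.le hc).1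
  omega

lemma PathLikeOn.numEdges_component_lt (h : PathLikeOn X Set.univ) (C : X.ConnectedComponent) :
    numEdges (X.induce (componentFinset C : Set V)) + 1 ≤ (componentFinset C).card :=
  numEdges_add_one_le_of_isContained_pathGraph (card_componentFinset_pos C).ne' (h.component C).2

/-- Two different components this large would contain disjoint connected five-sets. -/
lemma PathLikeOn.eq_of_five_le_card (h : PathLikeOn X Set.univ) {C D : X.ConnectedComponent}
    (hC : 5 ≤ (componentFinset C).card) (hD : 5 ≤ (componentFinset D).card) : C = D := by
  by_contra hne
  obtain ⟨T₁, hT₁, hc₁, hcon₁⟩ :=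
    exists_connected_subset_card_eq (connected_componentFinset C) (by omega) hC
  obtain ⟨T₂, hT₂, hc₂, hcon₂⟩ :=
    exists_connected_subset_card_eq (connected_componentFinset D) (by omega) hD
  exact h.2 T₁ T₂ (Set.subset_univ _) (Set.subset_univ _) hc₁ hc₂ hcon₁ hcon₂
    (Finset.disjoint_of_subset_left hT₁ (Finset.disjoint_of_subset_right hT₂
      (disjoint_componentFinset hne)))

lemma PathLikeOn.nonempty_iso_component (h : PathLikeOn X Set.univ) {C : X.ConnectedComponent}
    {k : ℕ} (hk : (componentFinset C).card = k + 1)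
    (he : k ≤ numEdges (X.induce (componentFinset C : Set V))) :
    Nonempty (X.induce (componentFinset C : Set V) ≃g pathGraph (k + 1)) := by
  have := (h.component C).2
  rw [hk] at this
  refine nonempty_iso_of_isContained this (by simp [hk]) ?_
  exact (numEdges_pathGraph_succ_le k).trans he

/-- The edge bound for path-like graphs, and the sizes of the components in case of equality. -/
lemma PathLikeOn.four_mul_numEdges_le (h : PathLikeOn X Set.univ) :
    4 * numEdges X ≤ 3 * Fintype.card V + 4 ∧
    (4 * numEdges X = 3 * Fintype.card V + 4 → ∃ C₀ : X.ConnectedComponent,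
      ((componentFinset C₀).card = 8 ∧
        numEdges (X.induce (componentFinset C₀ : Set V)) = 7) ∧
      ∀ C ≠ C₀, (componentFinset C).card = 4 ∧
        numEdges (X.induce (componentFinset C : Set V)) = 3) := by
  classical
  have := Fintype.ofFinite X.ConnectedComponent
  by_cases hex : ∃ C₀ : X.ConnectedComponent, 5 ≤ (componentFinset C₀).card
  · obtain ⟨C₀, hC₀⟩ := hex
    -- `4(c - 1) = 3c + (c - 4)`: the exceptional component gains at most `4`, only at `c = 8`, and
    -- the others gain nothing, breaking even only at `c = 4`. Equality of the sums forces equality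
    -- in each term.
    have hle : ∀ C ∈ Finset.univ, 4 * numEdges (X.induce (componentFinset C : Set V)) ≤
        3 * (componentFinset C).card + if C = C₀ then 4 else 0 := by
      intro C _
      have h1 := h.numEdges_component_lt C
      have h8 := (h.component C).1
      split_ifs with hC
      · omega
      · have : ¬ 5 ≤ (componentFinset C).card := fun h5 => hC (h.eq_of_five_le_card h5 hC₀)
        omega
    have hsum : ∑ C : X.ConnectedComponent,
        (3 * (componentFinset C).card + if C = C₀ then 4 else 0) = 3 * Fintype.card V + 4 := by
      rw [Finset.sum_add_distrib, ← Finset.mul_sum, sum_card_componentFinset]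
      simp
    rw [← sum_numEdges_componentFinset, Finset.mul_sum, ← hsum]
    refine ⟨Finset.sum_le_sum hle, fun heq => ⟨C₀, ?_, fun C hC => ?_⟩⟩
    · have h0 := (Finset.sum_eq_sum_iff_of_le hle).mp heq C₀ (Finset.mem_univ _)
      have h1 := h.numEdges_component_lt C₀
      have h8 := (h.component C₀).1
      rw [if_pos rfl] at h0
      omega
    · have h0 := (Finset.sum_eq_sum_iff_of_le hle).mp heq C (Finset.mem_univ _)
      have h1 := h.numEdges_component_lt C
      have h4 : ¬ 5 ≤ (componentFinset C).card := fun h5 => hC (h.eq_of_five_le_card h5 hC₀)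
      rw [if_neg hC] at h0
      omega
  · push Not at hex
    have hle : 4 * numEdges X ≤ 3 * Fintype.card V := by
      rw [← sum_numEdges_componentFinset, ← sum_card_componentFinset (X := X), Finset.mul_sum,
        Finset.mul_sum]
      refine Finset.sum_le_sum fun C _ => ?_
      have h1 := h.numEdges_component_lt C
      have h4 := hex C
      omega
    exact ⟨by omega, fun h => by omega⟩

lemma AdmissibleOn.four_mul_numEdges_le (h : AdmissibleOn X Set.univ) :
    4 * numEdges X ≤ 3 * Fintype.card V + 4 := by
  rcases h with h | h
  · exact h.four_mul_numEdges_le.1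
  · have := h.four_mul_numEdges_le
    omega

/-- The admissible graphs attaining the edge bound are disjoint unions of a `P_8` and
copies of `P_4`. -/
lemma AdmissibleOn.nonempty_iso (h : AdmissibleOn X Set.univ)
    (he : 4 * numEdges X = 3 * Fintype.card V + 4) {a : ℕ} (ha : Fintype.card V = 8 + 4 * a) :
    Nonempty (X ≃g pathGraph 8 ⊕g copies a (pathGraph 4)) := by
  classical
  have := Fintype.ofFinite X.ConnectedComponent
  rcases h with h | h
  swap
  · have := h.four_mul_numEdges_le
    omega
  obtain ⟨C₀, ⟨hc₀, he₀⟩, hC⟩ := h.four_mul_numEdges_le.2 he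
  obtain ⟨φ₀⟩ := h.nonempty_iso_component hc₀ he₀.ge
  have hφ : ∀ C : {C // C ≠ C₀}, Nonempty (X.induce (componentFinset C.1 : Set V) ≃g pathGraph 4) :=
    fun C => h.nonempty_iso_component (hC C.1 C.2).1 (hC C.1 C.2).2.ge
  have φ := fun C => (hφ C).some
  have hcard : Fintype.card {C // C ≠ C₀} = a := by
    have h1 := sum_card_componentFinset (X := X)
    rw [← Finset.add_sum_erase _ _ (Finset.mem_univ C₀), hc₀,
      Finset.sum_congr rfl (g := fun _ => 4) fun C h => (hC C (Finset.ne_of_mem_erase h)).1,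
      Finset.sum_const, smul_eq_mul, Finset.card_erase_of_mem (Finset.mem_univ _),
      Finset.card_univ] at h1
    rw [Fintype.card_subtype_compl, Fintype.card_subtype_eq]
    omega
  let ι : Fin a ≃ {C // C ≠ C₀} := (Fintype.equivFinOfCardEq hcard).symm
  let g : Fin 8 ⊕ (Fin a × Fin 4) → V :=
    Sum.elim (fun i => (φ₀.symm i).1) fun p => ((φ (ι p.1)).symm p.2).1
  have hg₀ : ∀ i, X.connectedComponentMk (g (Sum.inl i)) = C₀ := fun i =>
    mem_componentFinset.mp (φ₀.symm i).2
  have hg : ∀ p, X.connectedComponentMk (g (Sum.inr p)) = (ι p.1).1 := fun p =>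
    mem_componentFinset.mp ((φ (ι p.1)).symm p.2).2
  have hne : ∀ i p, X.connectedComponentMk (g (Sum.inl i)) ≠
      X.connectedComponentMk (g (Sum.inr p)) := fun i p hip =>
    (ι p.1).2 (((hg₀ i).symm.trans hip).trans (hg p)).symm
  have hidx : ∀ p q, X.connectedComponentMk (g (Sum.inr p)) =
      X.connectedComponentMk (g (Sum.inr q)) → p.1 = q.1 := fun p q hpq =>
    ι.injective (Subtype.ext (((hg p).symm.trans hpq).trans (hg q)))
  have hinj : Function.Injective g := by
    rintro (i | p) (j | q) hij
    · exact congrArg Sum.inl (φ₀.symm.injective (Subtype.ext hij))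
    · exact absurd (congrArg _ hij) (hne i q)
    · exact absurd (congrArg _ hij.symm) (hne j p)
    · obtain ⟨k, x⟩ := p
      obtain ⟨l, y⟩ := q
      obtain rfl : k = l := hidx _ _ (congrArg _ hij)
      rw [(φ (ι k)).symm.injective (Subtype.ext hij : (φ (ι k)).symm x = (φ (ι k)).symm y)]
  have hbij : Function.Bijective g := by
    rw [Fintype.bijective_iff_injective_and_card]
    refine ⟨hinj, ?_⟩
    simp [ha]
    omega
  refine ⟨RelIso.symm ⟨Equiv.ofBijective g hbij, ?_⟩⟩
  rintro (i | p) (j | q)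
  · exact φ₀.symm.map_adj_iff (v := i) (w := j)
  · exact iff_of_false (fun h => hne i q (ConnectedComponent.connectedComponentMk_eq_of_adj h)) (by simp)
  · exact iff_of_false
      (fun h => hne j p (ConnectedComponent.connectedComponentMk_eq_of_adj h.symm)) (by simp)
  · obtain ⟨k, x⟩ := p
    obtain ⟨l, y⟩ := q
    rw [sum_adj_inr]
    change X.Adj (g (Sum.inr (k, x))) (g (Sum.inr (l, y))) ↔ _
    constructor
    · intro hadj
      obtain rfl : k = l := hidx _ _ (ConnectedComponent.connectedComponentMk_eq_of_adj hadj)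
      exact ⟨rfl, (φ (ι k)).symm.map_adj_iff.mp hadj⟩
    · rintro ⟨rfl, hadj⟩
      exact (φ (ι k)).symm.map_adj_iff.mpr hadj

end Components

/-! ### Joins with `K_2` -/

section Join

variable {V W : Type} {G : SimpleGraph V} {H : SimpleGraph W}

@[simp] lemma join_adj_inl_inl {a b : V} :
    (join G H).Adj (Sum.inl a) (Sum.inl b) ↔ G.Adj a b := by simp [join]

@[simp] lemma join_adj_inr_inr {a b : W} :
    (join G H).Adj (Sum.inr a) (Sum.inr b) ↔ H.Adj a b := by simp [join]

@[simp] lemma join_adj_inl_inr {a : V} {b : W} :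
    (join G H).Adj (Sum.inl a) (Sum.inr b) := by simp [join]

@[simp] lemma join_adj_inr_inl {a : W} {b : V} :
    (join G H).Adj (Sum.inr a) (Sum.inl b) := by simp [join]

/-- Joins with a fixed graph respect isomorphism. -/
def joinCongr {W' : Type} {H' : SimpleGraph W'} (e : H ≃g H') : join G H ≃g join G H' where
  toEquiv := Equiv.sumCongr (Equiv.refl V) e.toEquiv
  map_rel_iff' := by
    rintro (a | a) (b | b)
    · simp
    · simp
    · simp
    · simpa using e.map_adj_iff

lemma numEdges_join [Finite V] [Finite W] :
    numEdges (join G H) = numEdges G + Nat.card V * Nat.card W + numEdges H := by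
  classical
  have := Fintype.ofFinite V
  have := Fintype.ofFinite W
  have hl : ∀ a, (join G H).degree (Sum.inl a) = G.degree a + Fintype.card W := by
    intro a
    rw [← card_neighborFinset_eq_degree, ← card_neighborFinset_eq_degree, ← Finset.card_univ,
      ← Finset.card_disjSum]
    congr 1
    ext (b | b) <;> simp
  have hr : ∀ a, (join G H).degree (Sum.inr a) = Fintype.card V + H.degree a := by
    intro a
    rw [← card_neighborFinset_eq_degree, ← card_neighborFinset_eq_degree, ← Finset.card_univ,
      ← Finset.card_disjSum]
    congr 1
    ext (b | b) <;> simp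
  refine Nat.eq_of_mul_eq_mul_left two_pos ?_
  rw [mul_add, mul_add, two_mul_numEdges_eq_sum_degree, two_mul_numEdges_eq_sum_degree,
    two_mul_numEdges_eq_sum_degree, Fintype.sum_sum_type]
  simp only [hl, hr, Finset.sum_add_distrib, Finset.sum_const, Finset.card_univ, smul_eq_mul,
    Nat.card_eq_fintype_card]
  ring

lemma numEdges_completeGraph_two : numEdges (completeGraph (Fin 2)) = 1 := by
  classical
  rw [numEdges, ← coe_edgeFinset, Set.ncard_coe_finset]
  decide

lemma numEdges_join_completeGraph_two {m : ℕ} {X : SimpleGraph (Fin m)} :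
    numEdges (join (completeGraph (Fin 2)) X) = 1 + 2 * m + numEdges X := by
  rw [numEdges_join, numEdges_completeGraph_two]
  simp

lemma AdmissibleOn.familyFree_join [Nonempty W] (h : AdmissibleOn H Set.univ) :
    FamilyFree obstructionFamily (join (completeGraph (Fin 2)) H) := by
  classical
  rw [familyFree_obstructionFamily_iff]
  refine ⟨Finset.univ.map ⟨Sum.inl, Sum.inl_injective⟩, by simp, ?_⟩
  -- The value on the two deleted vertices is a dummy.
  refine h.of_map (f := Sum.elim (fun _ => Classical.arbitrary W) id) ?_ (fun _ _ => trivial) ?_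
  · rintro (a | a) ha (b | b) hb hab
    · simp at ha
    · simp at ha
    · simp at hb
    · exact congrArg Sum.inr hab
  · rintro (a | a) ha (b | b) hb hab
    · simp at ha
    · simp at ha
    · simp at hb
    · simpa using hab

/-- Enlarge the deleted set to exactly two vertices and add every edge meeting it; this does not
affect what remains. -/
lemma FamilyFree.exists_join {n : ℕ} (hn : 2 ≤ n) {G : SimpleGraph (Fin n)}
    (h : FamilyFree obstructionFamily G) :
    ∃ (X : SimpleGraph (Fin (n - 2))) (e : Fin n ≃ Fin 2 ⊕ Fin (n - 2)),
      AdmissibleOn X Set.univ ∧ G ≤ (join (completeGraph (Fin 2)) X).comap e := by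
  classical
  obtain ⟨S, hS, hadm⟩ := familyFree_obstructionFamily_iff.mp h
  obtain ⟨S', hSS', hS'⟩ := Finset.exists_superset_card_eq (s := S) (n := 2) hS (by simpa using hn)
  let e₁ : {v // v ∈ S'} ≃ Fin 2 := Fintype.equivFinOfCardEq (by simpa using hS')
  let e₂ : {v // v ∉ S'} ≃ Fin (n - 2) := Fintype.equivFinOfCardEq (by
    rw [Fintype.card_subtype_compl]
    simp [hS'])
  let e : Fin n ≃ Fin 2 ⊕ Fin (n - 2) :=
    (Equiv.sumCompl (· ∈ S')).symm.trans (Equiv.sumCongr e₁ e₂)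
  have he : ∀ x : Fin (n - 2), e.symm (Sum.inr x) ∉ S' := fun x => by
    simpa [e] using (e₂.symm x).2
  refine ⟨G.comap fun x => e.symm (Sum.inr x), e, ?_, ?_⟩
  · refine hadm.of_map (f := fun x => e.symm (Sum.inr x))
      (e.symm.injective.comp Sum.inr_injective).injOn (fun x _ hx => he x (hSS' hx)) ?_
    intro a _ b _ hab
    exact hab
  · intro a b hab
    obtain ⟨a, rfl⟩ := e.symm.surjective a
    obtain ⟨b, rfl⟩ := e.symm.surjective b
    rw [comap_adj, Equiv.apply_symm_apply, Equiv.apply_symm_apply]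
    rcases a with a | a <;> rcases b with b | b
    · rw [join_adj_inl_inl, top_adj]
      rintro rfl
      exact hab.ne rfl
    · simp
    · simp
    · simpa using hab

end Join

/-! ### Admissible examples: copies of stars and blocks of paths -/

lemma eq_of_connected_induce {V β : Type} {G : SimpleGraph V} {T : Set V}
    (hT : (G.induce T).Connected) (f : V → β) (hf : ∀ a b, G.Adj a b → f a = f b) {a b : V}
    (ha : a ∈ T) (hb : b ∈ T) : f a = f b := by
  obtain ⟨w⟩ := hT.preconnected ⟨a, ha⟩ ⟨b, hb⟩
  suffices h : ∀ (x y : T), (G.induce T).Walk x y → f x = f y from h _ _ w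
  intro x y w
  induction w with
  | nil => rfl
  | cons h _ ih => exact (hf _ _ h).trans ih

lemma admissibleOn_copies_starGraph (b : ℕ) :
    AdmissibleOn (copies b (starGraph (0 : Fin 4))) Set.univ := by
  refine Or.inr fun T _ _ hT => ⟨⟨⟨fun a => a.1.2, fun {x y} h => h.2⟩, fun x y hxy => ?_⟩⟩
  exact Subtype.ext (Prod.ext
    (eq_of_connected_induce hT Prod.fst (fun _ _ h => h.1) x.2 y.2) hxy)

/-- The index of the block containing `i`: a first block of eight, then blocks of four. -/
def blockIndex (i : ℕ) : ℕ := if i < 8 then 0 else i / 4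

/-- A path on the first eight vertices followed by paths on four vertices. -/
def blockPath (m : ℕ) : SimpleGraph (Fin m) where
  Adj i j := (pathGraph m).Adj i j ∧ blockIndex i = blockIndex j
  symm := ⟨fun _ _ h => ⟨h.1.symm, h.2.symm⟩⟩
  loopless := ⟨fun _ h => (pathGraph m).irrefl h.1⟩

/-- Number `T` in increasing order: consecutive integers of `T` get consecutive ranks, since no
element lies between them. -/
lemma induce_isContained_pathGraph {m : ℕ} {G : SimpleGraph (Fin m)} (hG : G ≤ pathGraph m)
    (T : Finset (Fin m)) : G.induce (T : Set (Fin m)) ⊑ pathGraph T.card := by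
  let r : T ≃o Fin T.card := (T.orderIsoOfFin rfl).symm
  have key : ∀ x y : T, x.1.val + 1 = y.1.val → (r x).val + 1 = (r y).val := by
    intro x y hxy
    have hlt : r x < r y := r.lt_iff_lt.mpr (Fin.lt_def.mpr (by omega))
    by_contra hne
    have hlt' : (r x).val + 1 < (r y).val := by
      have := Fin.lt_def.mp hlt
      omega
    let z : Fin T.card := ⟨(r x).val + 1, by omega⟩
    have h1 : x < r.symm z := by
      rw [r.lt_symm_apply]
      exact Fin.lt_def.mpr (Nat.lt_succ_self _)
    have h2 : r.symm z < y := by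
      rw [r.symm_apply_lt]
      exact Fin.lt_def.mpr hlt'
    have h1' : x.1.val < (r.symm z).1.val := h1
    have h2' : (r.symm z).1.val < y.1.val := h2
    omega
  refine ⟨⟨⟨r, fun {x y} h => ?_⟩, r.injective⟩⟩
  rw [pathGraph_adj]
  exact (pathGraph_adj.mp (hG h)).imp (key _ _) (key _ _)

lemma card_le_of_forall_mem_Ico {m : ℕ} {T : Finset (Fin m)} {a k : ℕ}
    (h : ∀ x ∈ T, a ≤ x.val ∧ x.val < a + k) : T.card ≤ k := by
  have := Finset.card_le_card_of_injOn (s := T) (t := Finset.Ico a (a + k)) (fun x => x.val)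
    (fun x hx => by simpa using h x hx) Fin.val_injective.injOn
  simpa using this

/-- A connected set stays in one block. Only the first block can hold five vertices, and its eight
cannot hold two disjoint five-sets. -/
lemma admissibleOn_blockPath (m : ℕ) : AdmissibleOn (blockPath m) Set.univ := by
  have hblock : ∀ T : Finset (Fin m), ((blockPath m).induce (T : Set (Fin m))).Connected →
      (∀ x ∈ T, x.val < 8) ∨ ∃ q, ∀ x ∈ T, q * 4 ≤ x.val ∧ x.val < q * 4 + 4 := by
    intro T hT
    obtain ⟨⟨x, hx⟩⟩ := hT.nonempty
    have heq : ∀ y ∈ T, blockIndex x = blockIndex y := fun y hy =>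
      eq_of_connected_induce hT (fun x : Fin m => blockIndex x) (fun _ _ h => h.2) hx hy
    by_cases hx8 : x.val < 8
    · left
      intro y hy
      have := heq y hy
      simp only [blockIndex] at this
      split_ifs at this <;> omega
    · right
      refine ⟨x.val / 4, fun y hy => ?_⟩
      have := heq y hy
      simp only [blockIndex] at this
      split_ifs at this <;> omega
  have hle : blockPath m ≤ pathGraph m := fun _ _ h => h.1
  refine Or.inl ⟨fun T _ _ hT =>
    ⟨?_, induce_isContained_pathGraph hle T⟩, fun T₁ T₂ _ _ hc₁ hc₂ h₁ h₂ hd => ?_⟩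
  · rcases hblock T hT with h | ⟨q, h⟩
    · exact card_le_of_forall_mem_Ico (a := 0) fun x hx => by
        have := h x hx
        omega
    · exact (card_le_of_forall_mem_Ico h).trans (by omega)
  · have hlt : ∀ T : Finset (Fin m), T.card = 5 →
        ((blockPath m).induce (T : Set (Fin m))).Connected → ∀ x ∈ T, x.val < 8 := by
      intro T hc hT
      rcases hblock T hT with h | ⟨q, h⟩
      · exact h
      · have := card_le_of_forall_mem_Ico h
        omega
    have hc : (T₁ ∪ T₂).card ≤ 8 := card_le_of_forall_mem_Ico (a := 0) fun x hx => by
      rcases Finset.mem_union.mp hx with hx | hx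
      · have := hlt T₁ hc₁ h₁ x hx
        omega
      · have := hlt T₂ hc₂ h₂ x hx
        omega
    rw [Finset.card_union_of_disjoint hd] at hc
    omega

lemma le_numEdges_blockPath {m : ℕ} (hm : 8 ≤ m) :
    3 * (m / 4) + 1 ≤ numEdges (blockPath m) := by
  classical
  -- Left endpoints of edges: three in each full group of four, and at the last index the extra edge
  -- from `3` to `4` inside the first block.
  let f : ℕ → ℕ := fun j => if j = 3 * (m / 4) then 3 else 4 * (j / 3) + j % 3
  have hf : ∀ j < 3 * (m / 4) + 1, f j + 1 < m ∧ blockIndex (f j) = blockIndex (f j + 1) := by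
    intro j hj
    simp only [f, blockIndex]
    split_ifs <;> omega
  have hinj : ∀ i < 3 * (m / 4) + 1, ∀ j < 3 * (m / 4) + 1, f i = f j → i = j := by
    intro i hi j hj hij
    simp only [f] at hij
    split_ifs at hij <;> omega
  let g : Fin (3 * (m / 4) + 1) → (blockPath m).edgeSet := fun j =>
    ⟨s(⟨f j, (Nat.lt_succ_self _).trans (hf j j.2).1⟩, ⟨f j + 1, (hf j j.2).1⟩),
      pathGraph_adj.mpr (Or.inl rfl), (hf j j.2).2⟩
  have hg : Function.Injective g := by
    intro i j hij
    have hij' := congrArg Subtype.val hij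
    simp only [g, Sym2.eq_iff, Fin.mk.injEq] at hij'
    exact Fin.ext (hinj i i.2 j j.2 (by omega))
  rw [numEdges, ← Nat.card_coe_set_eq]
  simpa using Nat.card_le_card_of_injective g hg

/-! ### Eigenvalues through neighbour sums -/

section Spectrum

variable {V W : Type} [Fintype V] [Fintype W]

open scoped Classical in
/-- The sum of `y` over the neighbours of `i`. -/
noncomputable def neighborSum (G : SimpleGraph V) (y : V → ℝ) (i : V) : ℝ :=
  ∑ j, if G.Adj i j then y j else 0

open scoped Classical in
lemma mem_spectrum_adjMatrix_iff {G : SimpleGraph V} {μ : ℝ} :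
    μ ∈ spectrum ℝ (G.adjMatrix ℝ) ↔ ∃ y : V → ℝ, y ≠ 0 ∧ ∀ i, neighborSum G y i = μ * y i := by
  have happ : ∀ (y : V → ℝ) (i : V), Matrix.toLin' (G.adjMatrix ℝ) y i = neighborSum G y i := by
    intro y i
    rw [Matrix.toLin'_apply, Matrix.mulVec, dotProduct, neighborSum]
    refine Finset.sum_congr rfl fun j _ => ?_
    rw [adjMatrix_apply]
    split_ifs <;> simp
  rw [← Matrix.spectrum_toLin', ← Module.End.hasEigenvalue_iff_mem_spectrum]
  constructor
  · intro h
    obtain ⟨y, hy⟩ := h.exists_hasEigenvector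
    refine ⟨y, hy.2, fun i => ?_⟩
    rw [← happ, hy.apply_eq_smul]
    rfl
  · rintro ⟨y, hy, h⟩
    refine Module.End.hasEigenvalue_of_hasEigenvector (x := y)
      ⟨Module.End.mem_eigenspace_iff.mpr ?_, hy⟩
    ext i
    rw [happ, h]
    rfl

open scoped Classical in
lemma finite_spectrum_adjMatrix (G : SimpleGraph V) : (spectrum ℝ (G.adjMatrix ℝ)).Finite :=
  Matrix.finite_spectrum _

lemma le_lam {G : SimpleGraph V} {μ : ℝ} {y : V → ℝ} (hy : y ≠ 0)
    (h : ∀ i, neighborSum G y i = μ * y i) : μ ≤ lam G := by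
  classical
  exact le_csSup (finite_spectrum_adjMatrix G).bddAbove (mem_spectrum_adjMatrix_iff.mpr ⟨y, hy, h⟩)

lemma lam_eq_of_iso {G : SimpleGraph V} {H : SimpleGraph W} (e : G ≃g H) : lam G = lam H := by
  classical
  have key : ∀ {V W : Type} [Fintype V] [Fintype W] {G : SimpleGraph V} {H : SimpleGraph W}
      (_ : G ≃g H), spectrum ℝ (G.adjMatrix ℝ) ⊆ spectrum ℝ (H.adjMatrix ℝ) := by
    intro V W _ _ G H e μ hμ
    obtain ⟨y, hy, h⟩ := mem_spectrum_adjMatrix_iff.mp hμ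
    refine mem_spectrum_adjMatrix_iff.mpr ⟨fun i => y (e.symm i), fun h0 => hy ?_, fun i => ?_⟩
    · funext i
      simpa using congrFun h0 (e i)
    · rw [← h, neighborSum, neighborSum]
      refine Fintype.sum_equiv e.symm.toEquiv _ _ fun j => ?_
      have : G.Adj (e.symm i) (e.symm j) ↔ H.Adj i j := e.symm.map_adj_iff
      simp [this]
  have heq : spectrum ℝ (G.adjMatrix ℝ) = spectrum ℝ (H.adjMatrix ℝ) :=
    (key e).antisymm (key e.symm)
  unfold lam
  convert congrArg sSup heq

/-- A positive vector `x` with `A x ≤ μ x`, strict on a dominating set, shows `λ(G) < μ`. -/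
lemma lam_lt {G : SimpleGraph V} {μ : ℝ} (hμ : 0 < μ) {x : V → ℝ} (hx : ∀ i, 0 < x i)
    (h : ∀ i, neighborSum G x i ≤ μ * x i)
    (hs : ∀ i, neighborSum G x i < μ * x i ∨ ∃ j, G.Adj i j ∧ neighborSum G x j < μ * x j) :
    lam G < μ := by
  classical
  have key : ∀ κ ∈ spectrum ℝ (G.adjMatrix ℝ), κ < μ := by
    intro κ hκ
    obtain ⟨y, hy, hyκ⟩ := mem_spectrum_adjMatrix_iff.mp hκ
    by_contra! hle
    obtain ⟨i₀, hi₀⟩ := Function.ne_iff.mp hy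
    -- At a maximiser of `|y i| / x i`, an eigenvalue `κ ≥ μ` forces equality in every estimate, so
    -- all its neighbours are maximisers too, and one of these vertices is strict.
    obtain ⟨i, -, hi⟩ := Finset.exists_max_image Finset.univ (fun i => |y i| / x i)
      ⟨i₀, Finset.mem_univ _⟩
    set t := |y i| / x i with ht
    have hbound : ∀ j, |y j| ≤ t * x j := fun j => (div_le_iff₀ (hx j)).mp (hi j (Finset.mem_univ _))
    have htpos : 0 < t :=
      (div_pos (abs_pos.mpr hi₀) (hx i₀)).trans_le (hi i₀ (Finset.mem_univ _))
    have hterm : ∀ k, ∀ j ∈ Finset.univ, (if G.Adj k j then |y j| else 0) ≤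
        if G.Adj k j then t * x j else 0 := by
      intro k j _
      split_ifs
      · exact hbound j
      · exact le_rfl
    have hsum : ∀ k, (∑ j, if G.Adj k j then t * x j else 0) = t * neighborSum G x k := by
      intro k
      rw [neighborSum, Finset.mul_sum]
      exact Finset.sum_congr rfl fun j _ => by split_ifs <;> simp
    have hlow : ∀ k, |y k| = t * x k → μ * (t * x k) ≤ ∑ j, if G.Adj k j then |y j| else 0 := by
      intro k hk
      have h1 : |κ * y k| ≤ ∑ j, if G.Adj k j then |y j| else 0 := by
        rw [← hyκ k, neighborSum]
        refine (Finset.abs_sum_le_sum_abs _ _).trans_eq (Finset.sum_congr rfl fun j _ => ?_)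
        split_ifs <;> simp
      rw [abs_mul, hk] at h1
      refine le_trans ?_ h1
      exact mul_le_mul_of_nonneg_right (hle.trans (le_abs_self κ)) (mul_pos htpos (hx k)).le
    have hnot : ∀ k, |y k| = t * x k → ¬ neighborSum G x k < μ * x k := by
      intro k hk hlt
      have h1 := (hlow k hk).trans (Finset.sum_le_sum (hterm k))
      rw [hsum] at h1
      have h2 := mul_lt_mul_of_pos_left hlt htpos
      linarith
    have hi' : |y i| = t * x i := by
      rw [ht, div_mul_cancel₀ _ (hx i).ne']
    rcases hs i with hlt | ⟨j, hij, hlt⟩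
    · exact hnot i hi' hlt
    · refine hnot j ?_ hlt
      have heq : ∑ j, (if G.Adj i j then |y j| else 0) = ∑ j, if G.Adj i j then t * x j else 0 := by
        refine le_antisymm (Finset.sum_le_sum (hterm i)) ?_
        rw [hsum]
        refine le_trans ?_ (hlow i hi')
        have := mul_le_mul_of_nonneg_left (h i) htpos.le
        linarith
      have := (Finset.sum_eq_sum_iff_of_le (hterm i)).mp heq j (Finset.mem_univ _)
      simpa [hij] using this
  -- An empty spectrum gives the default `sSup ∅ = 0`, hence the need for `0 < μ`.
  rcases (spectrum ℝ (G.adjMatrix ℝ)).eq_empty_or_nonempty with he | hne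
  · rw [lam, he, Real.sSup_empty]
    exact hμ
  · exact key _ (hne.csSup_mem (finite_spectrum_adjMatrix G))

lemma neighborSum_join_inl {G : SimpleGraph V} {H : SimpleGraph W} {y : V ⊕ W → ℝ} {i : V} :
    neighborSum (join G H) y (Sum.inl i) =
      neighborSum G (fun j => y (Sum.inl j)) i + ∑ j, y (Sum.inr j) := by
  classical
  simp only [neighborSum, Fintype.sum_sum_type, join_adj_inl_inr, if_true]
  congr 1
  exact Finset.sum_congr rfl fun j _ => if_congr join_adj_inl_inl rfl rfl

lemma neighborSum_join_inr {G : SimpleGraph V} {H : SimpleGraph W} {y : V ⊕ W → ℝ} {i : W} :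
    neighborSum (join G H) y (Sum.inr i) =
      ∑ j, y (Sum.inl j) + neighborSum H (fun j => y (Sum.inr j)) i := by
  classical
  simp only [neighborSum, Fintype.sum_sum_type, join_adj_inr_inl, if_true]
  congr 1
  exact Finset.sum_congr rfl fun j _ => if_congr join_adj_inr_inr rfl rfl

lemma neighborSum_copies {a : ℕ} {G : SimpleGraph V} {y : V → ℝ} {p : Fin a × V} :
    neighborSum (copies a G) (fun q => y q.2) p = neighborSum G y p.2 := by
  classical
  rw [neighborSum, Fintype.sum_prod_type, Finset.sum_eq_single p.1]
  · simp [copies, neighborSum]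
  · intro k _ hk
    exact Finset.sum_eq_zero fun j _ => if_neg fun h => hk h.1.symm
  · simp

lemma neighborSum_sum_inl {G : SimpleGraph V} {H : SimpleGraph W} {y : V ⊕ W → ℝ} {i : V} :
    neighborSum (G ⊕g H) y (Sum.inl i) = neighborSum G (fun j => y (Sum.inl j)) i := by
  classical
  rw [neighborSum, Fintype.sum_sum_type, neighborSum]
  exact (congrArg₂ (· + ·) (Finset.sum_congr rfl fun j _ => if_congr sum_adj_inl rfl rfl)
    (Finset.sum_eq_zero fun j _ => if_neg (by simp))).trans (add_zero _)

lemma neighborSum_sum_inr {G : SimpleGraph V} {H : SimpleGraph W} {y : V ⊕ W → ℝ} {i : W} :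
    neighborSum (G ⊕g H) y (Sum.inr i) = neighborSum H (fun j => y (Sum.inr j)) i := by
  classical
  rw [neighborSum, Fintype.sum_sum_type, neighborSum]
  exact (congrArg₂ (· + ·) (Finset.sum_eq_zero fun j _ => if_neg (by simp))
    (Finset.sum_congr rfl fun j _ => if_congr sum_adj_inr rfl rfl)).trans (zero_add _)

end Spectrum

/-! ### Comparing the path join with the star join -/

lemma neighborSum_completeGraph_two (i : Fin 2) :
    neighborSum (completeGraph (Fin 2)) (fun _ => 1) i = 1 := by
  fin_cases i <;> simp [neighborSum, Fin.sum_univ_two]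

lemma neighborSum_pathGraph_eight_le {w : ℝ} (hw : 0 ≤ w) (i : Fin 8) :
    neighborSum (pathGraph 8) (fun _ => w) i ≤ 2 * w := by
  fin_cases i <;> simp [neighborSum, Fin.sum_univ_eight, pathGraph_adj] <;> linarith

/-- The largest eigenvalue of `K_2 + b K_{1,3}` is at least any root of the characteristic
equation of its quotient. -/
lemma le_lam_join_copies_starGraph {b : ℕ} {μ : ℝ} (hμ : 2 ≤ μ)
    (h : (μ - 1) * (μ ^ 2 - 3) = b * (8 * μ + 12)) :
    μ ≤ lam (join (completeGraph (Fin 2)) (copies b (starGraph (0 : Fin 4)))) := by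
  have hpos : μ ^ 2 - 3 ≠ 0 := by nlinarith
  -- Centre and leaf weights solve `μ c = 2 + 3 l` and `μ l = 2 + c`; the equation on `K_2`, `μ = 1
  -- + b (c + 3 l)`, is then `h`.
  let c : ℝ := (2 * μ + 6) / (μ ^ 2 - 3)
  let l : ℝ := (2 * μ + 2) / (μ ^ 2 - 3)
  let s : Fin 4 → ℝ := ![c, l, l, l]
  refine le_lam (y := Sum.elim (fun _ => 1) fun p => s p.2)
    (fun h0 => by simpa using congrFun h0 (Sum.inl 0)) ?_
  rintro (i | ⟨k, i⟩)
  · rw [neighborSum_join_inl]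
    simp only [Sum.elim_inl, Sum.elim_inr, neighborSum_completeGraph_two]
    rw [Fintype.sum_prod_type]
    simp only [Finset.sum_const, Finset.card_univ, Fintype.card_fin, nsmul_eq_mul,
      Fin.sum_univ_four, s]
    simp [c, l]
    field_simp
    linarith
  · rw [neighborSum_join_inr]
    simp only [Sum.elim_inl, Sum.elim_inr]
    rw [neighborSum_copies]
    fin_cases i <;> simp [neighborSum, Fin.sum_univ_four, s, c, l] <;> field_simp <;> ring

/-- An upper bound on the largest eigenvalue of `K_2 + (P_8 ∪ a P_4)`. -/
lemma lam_join_paths_lt {a : ℕ} {μ : ℝ} (hμ : 3 ≤ μ)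
    (h : 1 + a * ((8 * μ + 4) / (μ ^ 2 - μ - 1)) + 16 / (μ - 2) < μ) :
    lam (join (completeGraph (Fin 2)) (pathGraph 8 ⊕g copies a (pathGraph 4))) < μ := by
  have hpos : 0 < μ ^ 2 - μ - 1 := by nlinarith
  have hpos' : 0 < μ - 2 := by linarith
  have hne := hpos.ne'
  have hne' := hpos'.ne'
  -- End and inner weights of `P_4`. On `P_8` the constant `w` with `μ w = 2 + 2 w` suffices, since
  -- degrees there are at most two. Strictness is needed only on `K_2`, which dominates.
  let p : ℝ := 2 * μ / (μ ^ 2 - μ - 1)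
  let q : ℝ := (2 * μ + 2) / (μ ^ 2 - μ - 1)
  let w : ℝ := 2 / (μ - 2)
  have hp : 0 < p := by positivity
  have hq : 0 < q := by positivity
  have hw : 0 < w := by positivity
  have hpq : 2 + q = μ * p := by
    simp only [p, q]
    generalize hD : μ ^ 2 - μ - 1 = D at hne
    field_simp
    rw [← hD]
    ring
  have hqp : 2 + (p + q) = μ * q := by
    simp only [p, q]
    generalize hD : μ ^ 2 - μ - 1 = D at hne
    field_simp
    rw [← hD]
    ring
  let s : Fin 4 → ℝ := ![p, q, q, p]
  let y : Fin 2 ⊕ (Fin 8 ⊕ (Fin a × Fin 4)) → ℝ :=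
    Sum.elim (fun _ => 1) (Sum.elim (fun _ => w) fun r => s r.2)
  have hl : ∀ i, neighborSum (join (completeGraph (Fin 2))
      (pathGraph 8 ⊕g copies a (pathGraph 4))) y (Sum.inl i) < μ * y (Sum.inl i) := by
    intro i
    rw [neighborSum_join_inl]
    simp only [y, Sum.elim_inl, Sum.elim_inr, neighborSum_completeGraph_two, mul_one]
    rw [Fintype.sum_sum_type]
    simp only [Sum.elim_inl, Sum.elim_inr]
    rw [Fintype.sum_prod_type]
    simp only [Finset.sum_const, Finset.card_univ, Fintype.card_fin, nsmul_eq_mul,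
      Fin.sum_univ_four, s]
    refine lt_of_eq_of_lt ?_ h
    simp [p, q, w]
    field_simp
    ring
  refine lam_lt (by linarith) (x := y) ?_ ?_ ?_
  · rintro (i | i | ⟨k, i⟩)
    · exact one_pos
    · exact hw
    · change 0 < s i
      fin_cases i
      exacts [hp, hq, hq, hp]
  · rintro (i | i | ⟨k, i⟩)
    · exact (hl i).le
    · rw [neighborSum_join_inr, neighborSum_sum_inl]
      have h8 := neighborSum_pathGraph_eight_le hw.le i
      have hw' : 2 + 2 * w = μ * w := by
        simp only [w]
        field_simp
        ring
      simp only [y, Sum.elim_inl, Sum.elim_inr, Fin.sum_univ_two]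
      linarith
    · rw [neighborSum_join_inr, neighborSum_sum_inr]
      simp only [y, Sum.elim_inl, Sum.elim_inr]
      rw [neighborSum_copies]
      refine le_of_eq ?_
      fin_cases i <;>
        simp [neighborSum, Fin.sum_univ_four, pathGraph_adj, s] <;> linarith
  · rintro (i | i)
    · exact Or.inl (hl i)
    · exact Or.inr ⟨Sum.inl 0, by simp, hl 0⟩

/-- Replacing `P_8 ∪ a P_4` by `(a + 2) K_{1,3}` increases the largest eigenvalue of the join
with `K_2`, although it decreases the number of edges. -/
lemma lam_join_paths_lt_lam_join_stars {a : ℕ} (ha : 50 ≤ a) :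
    lam (join (completeGraph (Fin 2)) (pathGraph 8 ⊕g copies a (pathGraph 4))) <
      lam (join (completeGraph (Fin 2)) (copies (a + 2) (starGraph (0 : Fin 4)))) := by
  have ha' : (50 : ℝ) ≤ a := by exact_mod_cast ha
  -- The bound `21` exceeds the larger root of `μ ^ 2 - 19 * μ - 22`, the factor that decides the
  -- comparison; `50 ≤ a` makes the function nonpositive there.
  obtain ⟨μ, ⟨hμ, -⟩, hroot⟩ : ∃ μ ∈ Set.Icc (21 : ℝ) (21 + 20 * a),
      (μ - 1) * (μ ^ 2 - 3) - ((a + 2 : ℕ) : ℝ) * (8 * μ + 12) = 0 := by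
    refine intermediate_value_Icc (f := fun μ : ℝ =>
      (μ - 1) * (μ ^ 2 - 3) - ((a + 2 : ℕ) : ℝ) * (8 * μ + 12)) (by linarith) (by fun_prop)
      ⟨?_, ?_⟩
    · push_cast
      norm_num
      linarith
    · push_cast
      have : (0 : ℝ) ≤ a * a := by positivity
      have : (0 : ℝ) ≤ a * a * a := by positivity
      nlinarith
  have hroot' : (μ - 1) * (μ ^ 2 - 3) = ((a + 2 : ℕ) : ℝ) * (8 * μ + 12) := by linarith
  refine lt_of_lt_of_le (lam_join_paths_lt (by linarith) ?_)
    (le_lam_join_copies_starGraph (by linarith) hroot')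
  have h1 : 0 < μ ^ 2 - μ - 1 := by nlinarith
  have h2 : 0 < μ - 2 := by linarith
  have h3 : 0 < 8 * μ + 12 := by linarith
  have h1' := h1.ne'
  have h2' := h2.ne'
  have h3' := h3.ne'
  have ha2 : (a : ℝ) = (μ - 1) * (μ ^ 2 - 3) / (8 * μ + 12) - 2 := by
    rw [hroot']
    push_cast
    field_simp
    ring
  have hdiff : μ - (1 + a * ((8 * μ + 4) / (μ ^ 2 - μ - 1)) + 16 / (μ - 2)) =
      4 * μ * (μ ^ 2 - 19 * μ - 22) / ((8 * μ + 12) * (μ ^ 2 - μ - 1) * (μ - 2)) := by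
    rw [ha2]
    generalize hD : μ ^ 2 - μ - 1 = D at h1'
    field_simp
    rw [← hD]
    ring
  have hpos : 0 < 4 * μ * (μ ^ 2 - 19 * μ - 22) / ((8 * μ + 12) * (μ ^ 2 - μ - 1) * (μ - 2)) := by
    have : 0 < μ ^ 2 - 19 * μ - 22 := by nlinarith
    positivity
  linarith

/-! ### Extremal graphs and failure of the spectral inclusion -/

lemma exists_familyFree_forall_le {𝓕 : GraphFamily} {n : ℕ} {α : Type} [LinearOrder α]
    (f : SimpleGraph (Fin n) → α) {G₀ : SimpleGraph (Fin n)} (h₀ : FamilyFree 𝓕 G₀) :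
    ∃ G, FamilyFree 𝓕 G ∧ ∀ G', FamilyFree 𝓕 G' → f G' ≤ f G := by
  obtain ⟨G, hG, hmax⟩ := Set.exists_max_image {G : SimpleGraph (Fin n) | FamilyFree 𝓕 G} f
    (Set.toFinite _) ⟨G₀, h₀⟩
  exact ⟨G, hG, hmax⟩

/-- Any graph on `n` vertices has a copy on the vertex set `Fin n`. -/
lemma exists_iso_fin {V : Type} [Fintype V] (H : SimpleGraph V) {n : ℕ} (hn : Fintype.card V = n) :
    ∃ G : SimpleGraph (Fin n), Nonempty (G ≃g H) :=
  ⟨H.comap (Fintype.equivFinOfCardEq hn).symm, ⟨Iso.comap _ H⟩⟩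

lemma exists_familyFree_obstructionFamily {n : ℕ} (hn : 10 ≤ n) :
    ∃ G : SimpleGraph (Fin n), FamilyFree obstructionFamily G ∧
      1 + 2 * (n - 2) + (3 * ((n - 2) / 4) + 1) ≤ numEdges G := by
  have : Nonempty (Fin (n - 2)) := ⟨⟨0, by omega⟩⟩
  obtain ⟨G, ⟨e⟩⟩ := exists_iso_fin (join (completeGraph (Fin 2)) (blockPath (n - 2))) (n := n)
    (by simp; omega)
  refine ⟨G, (admissibleOn_blockPath _).familyFree_join.of_isContained e.isContained, ?_⟩
  rw [numEdges_eq_of_iso e, numEdges_join_completeGraph_two]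
  have := le_numEdges_blockPath (m := n - 2) (by omega)
  omega

lemma FamilyFree.numEdges_le {n : ℕ} (hn : 2 ≤ n) {G : SimpleGraph (Fin n)}
    (h : FamilyFree obstructionFamily G) : numEdges G ≤ 4 * n := by
  obtain ⟨X, e, hX, hle⟩ := h.exists_join hn
  have h1 := numEdges_le_of_isContained
    ((IsContained.of_le hle).trans (Iso.comap e _).isContained)
  rw [numEdges_join_completeGraph_two] at h1
  have h2 := hX.four_mul_numEdges_le
  rw [Fintype.card_fin] at h2
  omega

/-- The join containing `G` is itself free, so maximality makes `G` equal to it; comparison with the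
block path gives the lower bound. -/
lemma exists_iso_join_of_mem_EX {n : ℕ} (hn : 10 ≤ n) {G : SimpleGraph (Fin n)}
    (hG : G ∈ EX n obstructionFamily) :
    ∃ X : SimpleGraph (Fin (n - 2)), Nonempty (G ≃g join (completeGraph (Fin 2)) X) ∧
      AdmissibleOn X Set.univ ∧ 3 * ((n - 2) / 4) + 1 ≤ numEdges X ∧
      4 * numEdges X ≤ 3 * (n - 2) + 4 := by
  have : Nonempty (Fin (n - 2)) := ⟨⟨0, by omega⟩⟩
  obtain ⟨X, e, hX, hle⟩ := hG.1.exists_join (by omega)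
  have heq : G = (join (completeGraph (Fin 2)) X).comap e :=
    eq_of_le_of_numEdges_le hle
      (hG.2 _ (hX.familyFree_join.of_isContained (Iso.comap e _).isContained))
  have hiso : G ≃g join (completeGraph (Fin 2)) X := heq ▸ Iso.comap e _
  refine ⟨X, ⟨hiso⟩, hX, ?_, by simpa using hX.four_mul_numEdges_le⟩
  obtain ⟨G₀, hG₀, he₀⟩ := exists_familyFree_obstructionFamily hn
  have h1 := he₀.trans (hG.2 G₀ hG₀)
  rw [numEdges_eq_of_iso hiso, numEdges_join_completeGraph_two] at h1
  omega

lemma EX_nonempty {n : ℕ} (hn : 10 ≤ n) : (EX n obstructionFamily).Nonempty := by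
  obtain ⟨G₀, hG₀, -⟩ := exists_familyFree_obstructionFamily hn
  exact exists_familyFree_forall_le numEdges hG₀

lemma mem_EX_of_iso {𝓕 : GraphFamily} {n : ℕ} {G G' : SimpleGraph (Fin n)} (hG : G ∈ EX n 𝓕)
    (e : G' ≃g G) : G' ∈ EX n 𝓕 := by
  refine ⟨hG.1.of_isContained e.isContained, fun H hH => ?_⟩
  rw [numEdges_eq_of_iso e]
  exact hG.2 H hH

/-- In this residue class `4 ∣ n - 2`, so the lower and upper bounds on `e(X)` coincide and the
equality case applies. -/
lemma mem_EX_iff_of_mod_four {n : ℕ} (hn : 10 ≤ n) (hmod : n ≡ 2 [MOD 4])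
    {G : SimpleGraph (Fin n)} :
    G ∈ EX n obstructionFamily ↔ Nonempty (G ≃g join (completeGraph (Fin 2))
      (pathGraph 8 ⊕g copies ((n - 10) / 4) (pathGraph 4))) := by
  have hmod' : n % 4 = 2 := hmod
  have key : ∀ G ∈ EX n obstructionFamily, Nonempty (G ≃g join (completeGraph (Fin 2))
      (pathGraph 8 ⊕g copies ((n - 10) / 4) (pathGraph 4))) := by
    intro G hG
    obtain ⟨X, ⟨e⟩, hX, hlow, hup⟩ := exists_iso_join_of_mem_EX hn hG
    obtain ⟨φ⟩ := hX.nonempty_iso (a := (n - 10) / 4) (by rw [Fintype.card_fin]; omega)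
      (by rw [Fintype.card_fin]; omega)
    exact ⟨(joinCongr φ).comp e⟩
  refine ⟨key G, fun ⟨e⟩ => ?_⟩
  obtain ⟨G₀, hG₀⟩ := EX_nonempty hn
  obtain ⟨e₀⟩ := key G₀ hG₀
  exact mem_EX_of_iso hG₀ (e₀.symm.comp e)

lemma SPEX_inter_EX_eq_empty {n : ℕ} (hn : 210 ≤ n) (hmod : n ≡ 2 [MOD 4]) :
    SPEX n obstructionFamily ∩ EX n obstructionFamily = ∅ := by
  have hmod' : n % 4 = 2 := hmod
  rw [Set.eq_empty_iff_forall_notMem]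
  rintro G ⟨hS, hE⟩
  obtain ⟨e⟩ := (mem_EX_iff_of_mod_four (by omega) hmod).mp hE
  obtain ⟨G', ⟨e'⟩⟩ := exists_iso_fin (n := n) (join (completeGraph (Fin 2))
    (copies ((n - 10) / 4 + 2) (starGraph (0 : Fin 4)))) (by simp; omega)
  have hle := hS.2 G'
    ((admissibleOn_copies_starGraph _).familyFree_join.of_isContained e'.isContained)
  rw [lam_eq_of_iso e, lam_eq_of_iso e'] at hle
  exact absurd hle (lam_join_paths_lt_lam_join_stars (by omega)).not_ge

lemma isBigO_ex_obstructionFamily :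
    (fun n : ℕ => (ex n obstructionFamily : ℝ)) =O[atTop] fun n : ℕ => (n : ℝ) := by
  classical
  refine IsBigO.of_bound 4 ?_
  filter_upwards [eventually_ge_atTop 2] with n hn
  have h : ex n obstructionFamily ≤ 4 * n := by
    refine Finset.sup_le fun G hG => ?_
    exact (Finset.mem_filter.mp hG).2.numEdges_le hn
  simp only [Real.norm_natCast]
  exact_mod_cast h

/-- Unrestricted extremal graphs already contain `K_{2,n-2}`, so they are extremal under that
restriction too. -/
lemma hasLinearJoinExtremal_obstructionFamily :
    HasLinearJoinExtremal obstructionFamily 2 (3 / 4) := by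
  refine ⟨obstructionFamily_finite, isBigO_ex_obstructionFamily,
    not_familyFree_completeBipartiteGraph, 0, ?_⟩
  filter_upwards [eventually_ge_atTop 10] with n hn
  obtain ⟨G, hG⟩ := EX_nonempty hn
  obtain ⟨X, ⟨e⟩, -, -, hup⟩ := exists_iso_join_of_mem_EX hn hG
  refine ⟨G, ⟨⟨hG.1, ?_⟩, fun G' hG' _ => hG.2 G' hG'⟩, X, ⟨e⟩, ?_⟩
  · exact (IsContained.of_le le_sup_right).trans e.isContained'
  · have : 4 * numEdges X ≤ 3 * n := by omega
    have : (4 * numEdges X : ℝ) ≤ 3 * n := by exact_mod_cast this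
    linarith

/-- Some unrestricted extremal graph contains the required join, so the restricted and unrestricted
maxima agree, and the inclusion would put a spectral maximiser in `EX`. -/
lemma not_spexSubsetEventually_obstructionFamily :
    ¬ SpexSubsetEventually obstructionFamily 2 := by
  intro h
  obtain ⟨N, hN⟩ := eventually_atTop.mp h
  -- The shift `52` gives `n ≥ 210`, which is `(n - 10) / 4 ≥ 50`.
  let n := 4 * (N + 52) + 2
  have hn : 210 ≤ n := by omega
  have hmod : n ≡ 2 [MOD 4] := by
    change n % 4 = 2
    omega
  obtain ⟨G₀, hG₀⟩ := EX_nonempty (n := n) (by omega)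
  obtain ⟨X, ⟨e⟩, -⟩ := exists_iso_join_of_mem_EX (by omega) hG₀
  obtain ⟨G, hG⟩ : (SPEX n obstructionFamily).Nonempty := exists_familyFree_forall_le lam hG₀.1
  have hsub := hN n (by omega) hG
  have hle : numEdges G₀ ≤ numEdges G := by
    refine hsub.2 G₀ hG₀.1 (IsContained.trans (IsContained.of_le ?_) e.isContained')
    rintro (a | a) (b | b) hab
    · simpa using hab
    · simp
    · simp
    · simp at hab
  have hE : G ∈ EX n obstructionFamily := ⟨hG.1, fun G' hG' => (hG₀.2 G' hG').trans hle⟩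
  have hmem : G ∈ SPEX n obstructionFamily ∩ EX n obstructionFamily := ⟨hG, hE⟩
  rw [SPEX_inter_EX_eq_empty hn hmod] at hmem
  exact hmem

end TuranSpectral

theorem proposition1p2 :
    ∃ 𝓕 : TuranSpectral.GraphFamily, 𝓕.Finite ∧
      -- For all large `n`, the extremal graphs are `K_2 + X` with `e(X) = 3n/4 + O(1)`.
      (∃ C : ℝ, ∀ᶠ n : ℕ in atTop,
        (TuranSpectral.EX n 𝓕).Nonempty ∧
        ∀ G ∈ TuranSpectral.EX n 𝓕, ∃ X : SimpleGraph (Fin (n - 2)),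
          Nonempty (G ≃g TuranSpectral.join (completeGraph (Fin 2)) X) ∧
          |(TuranSpectral.numEdges X : ℝ) - 3 * (n : ℝ) / 4| ≤ C) ∧
      -- For large `n ≡ 2 (mod 4)` there is exactly one, `K_2 + (P_8 ∪ ((n - 10) / 4) · P_4)`.
      (∀ᶠ n : ℕ in atTop, n ≡ 2 [MOD 4] →
        ∀ G : SimpleGraph (Fin n), G ∈ TuranSpectral.EX n 𝓕 ↔
          Nonempty (G ≃g TuranSpectral.join (completeGraph (Fin 2))
            (pathGraph 8 ⊕g TuranSpectral.copies ((n - 10) / 4) (pathGraph 4)))) ∧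
      -- For infinitely many `n`, even among `n ≡ 2 (mod 4)`, `SPEX` and `EX` are disjoint.
      {n : ℕ | n ≡ 2 [MOD 4] ∧ TuranSpectral.SPEX n 𝓕 ∩ TuranSpectral.EX n 𝓕 = ∅}.Infinite ∧
      -- The implication known for `Q < 3/4` fails at `Q = 3/4`.
      TuranSpectral.HasLinearJoinExtremal 𝓕 2 (3 / 4) ∧
      ¬ TuranSpectral.SpexSubsetEventually 𝓕 2 := by
  refine ⟨TuranSpectral.obstructionFamily, TuranSpectral.obstructionFamily_finite, ⟨3, ?_⟩, ?_, ?_,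
    TuranSpectral.hasLinearJoinExtremal_obstructionFamily,
    TuranSpectral.not_spexSubsetEventually_obstructionFamily⟩
  · filter_upwards [eventually_ge_atTop 10] with n hn
    refine ⟨TuranSpectral.EX_nonempty hn, fun G hG => ?_⟩
    obtain ⟨X, e, -, hlow, hup⟩ := TuranSpectral.exists_iso_join_of_mem_EX hn hG
    refine ⟨X, e, ?_⟩
    have h1 : 3 * n ≤ 4 * TuranSpectral.numEdges X + 12 := by omega
    have h2 : 4 * TuranSpectral.numEdges X ≤ 3 * n := by omega
    have h1' : (3 * n : ℝ) ≤ 4 * TuranSpectral.numEdges X + 12 := by exact_mod_cast h1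
    have h2' : (4 * TuranSpectral.numEdges X : ℝ) ≤ 3 * n := by exact_mod_cast h2
    rw [abs_le]
    constructor <;> linarith
  · filter_upwards [eventually_ge_atTop 10] with n hn hmod G
    exact TuranSpectral.mem_EX_iff_of_mod_four hn hmod
  · refine Set.infinite_of_injective_forall_mem (f := fun a : ℕ => 4 * (a + 52) + 2)
      (fun a b hab => by simpa using hab) fun a => ?_
    have hmod : 4 * (a + 52) + 2 ≡ 2 [MOD 4] := by
      change _ % 4 = 2
      omega
    exact ⟨hmod, TuranSpectral.SPEX_inter_EX_eq_empty (by omega) hmod⟩
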